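/- Conventions. A length function $l$ on a group induces the left-invariant metric $d(x,y)=l(x^{-1}y)$. The Hilbert space compression of a metric space $(X,d)$ is the supremum of all $\delta\in[0,1]$ for which there exist a Hilbert space $\mathcal H$, a map $f:X\to\mathcal H$ and constants $C,C',D'>0$, $D\ge 0$ such that \[ \tfrac{1}{C'}\,d(x,y)^{\delta}-D'\ \le\ \|f(x)-f(y)\|\ \le\ C\,d(x,y)+D\qquad\text{for all }x,y\in X \] (so bounded spaces, in particular finite groups, have compression $1$). A metric space $(X,d)$ is Gromov-hyperbolic if there is $\varepsilon\ge 0$ such that $(x|z)_o\ge\min\{(x|y)_o,(y|z)_o\}-\varepsilon$ for all $o,x,y,z\in X$, where $(x|y)_o=\frac12\big(d(x,o)+d(y,o)-d(x,y)\big)$. Theorem. Let $\Gamma$ be a finitely generated group, equipped with the word length function $l_\Gamma$ relative to a finite symmetric generating subset $S$, and suppose that $\Gamma$ fits in a short exact sequence of groups \[ 1\to H\to\Gamma\xrightarrow{\ \pi\ }G\to 1. \] Equip $G$ with the word length function relative to $\pi(S)$, and $H$ with the restriction of $l_\Gamma$ to $H$. If $G$ is Gromov-hyperbolic and $H$, with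 this induced metric, has Hilbert space compression $\delta$, then the Hilbert space compression of $\Gamma$, with respect to $l_\Gamma$, is at least $\delta/5$. -/

import Mathlib

open scoped Pointwise

universe u

/-- The word length of `g` relative to a subset `S` of a group: the least length of a word in
the letters of `S` whose product is `g`. (It is meant for symmetric generating sets `S`, for which
every `g` is such a product.) -/
noncomputable def wordLength {Γ : Type*} [Group Γ] (S : Set Γ) (g : Γ) : ℝ :=
  ((sInf {n : ℕ | ∃ w : List Γ, (∀ s ∈ w, s ∈ S) ∧ w.prod = g ∧ w.length = n} : ℕ) : ℝ)

/-- The left-invariant distance `d(x, y) = l(x⁻¹ y)` induced by a length function `l`. -/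
def lengthDist {Γ : Type*} [Group Γ] (l : Γ → ℝ) (x y : Γ) : ℝ := l (x⁻¹ * y)

/-- `δ` is a compression exponent of `(X, d)`: there is a map `f` from `X` to a Hilbert space with
`(1/C') d(x,y)^δ - D' ≤ ‖f x - f y‖ ≤ C d(x,y) + D` for all `x, y`. For `δ > 0`
this says that `f` is a large-scale Lipschitz uniform embedding whose lower control function can be
taken to be `r ↦ (1/C') r^δ - D'` (or its positive part). -/
def IsCompressionExponent {X : Type u} (d : X → X → ℝ) (δ : ℝ) : Prop :=
  ∃ (E : Type u) (_ : NormedAddCommGroup E) (_ : InnerProductSpace ℝ E) (_ : CompleteSpace E)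
    (f : X → E),
    (∃ C > (0 : ℝ), ∃ D ≥ (0 : ℝ), ∀ x y, ‖f x - f y‖ ≤ C * d x y + D) ∧
    (∃ C' > (0 : ℝ), ∃ D' > (0 : ℝ), ∀ x y, (1 / C') * d x y ^ δ - D' ≤ ‖f x - f y‖)

/-- The Hilbert space compression of `(X, d)`: the supremum of its compression exponents
`δ ∈ [0, 1]`. The exponent `0` always occurs, and no exponent `> 1` can occur for an unbounded
space; the restriction to `δ ≤ 1` gives bounded spaces, such as finite groups, compression `1`. -/
noncomputable def hilbertCompression {X : Type*} (d : X → X → ℝ) : ℝ :=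
  sSup {δ : ℝ | 0 ≤ δ ∧ δ ≤ 1 ∧ IsCompressionExponent d δ}

/-- The Gromov product `(x | y)_o`. -/
noncomputable def gromovProduct {X : Type*} (d : X → X → ℝ) (o x y : X) : ℝ :=
  (d x o + d y o - d x y) / 2

/-- Hyperbolicity in the sense of Gromov:
`(x | z)_o ≥ min ((x | y)_o) ((y | z)_o) - ε` for some `ε ≥ 0` and all points. -/
def IsGromovHyperbolic {X : Type*} (d : X → X → ℝ) : Prop :=
  ∃ ε ≥ (0 : ℝ), ∀ o x y z : X,
    min (gromovProduct d o x y) (gromovProduct d o y z) - ε ≤ gromovProduct d o x z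

/-!
The group `Γ` is embedded by gluing copies of an embedding `f` of `H` along the quotient `G`.

Over a ball of radius `2 n` in `G` with centre `z`, the extension is `H` up to an additive error of
order `n`: with a lift `σ` of minimal length, `a ↦ σ(z)⁻¹ a σ(z⁻¹ π(a))⁻¹` is a local coordinate
with values in `H` (`GroupExtension.exists_local_coordinates`). The local maps obtained from `f`
are made bounded by replacing `f` with the feature map of the Gaussian kernel
`exp (-‖f h - f h'‖ ^ 2 / n ^ 4)`, and are added up with weights `ξ (π a) z`. The kernel of the sum
is positive semidefinite, so Moore's theorem on reproducing kernels provides the Hilbert space, and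
squared distances are explicit finite sums (`exists_gaussian_feature_map`).

The weights are tent functions of height `n` which are `1`-Lipschitz in `π a` and have supports of
only `O(n)` points (`exists_tent_family`). This is where hyperbolicity enters: all geodesics from
`1` to points of an `n`-ball have come together, up to a constant, once they are `n` steps away
from their end points, so the points used lie near a geodesic segment of length `2 n`.

The resulting map at scale `n` has Lipschitz constant `O(√n)`, and it separates `a` and `b` by `n / 2`
as soon as `d(a, b) ^ δ` exceeds a multiple of `n ^ 2` (`GroupExtension.exists_scale_map`). Take
`n = 32 ^ k` with weight `8 ^ (-k)`: the Lipschitz constants become `O(2 ^ (-k / 2))`, which is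
square summable, and points with `d(a, b) ^ δ` of order `n ^ 2 = 4 ^ (5 k)` are separated by
`4 ^ k / 2`, which is the exponent `δ / 5`.
-/

/-! ### Word norms -/

/-- The word length with values in `ℕ`. -/
noncomputable def wordNorm {Γ : Type*} [Group Γ] (S : Set Γ) (g : Γ) : ℕ :=
  sInf {n : ℕ | ∃ w : List Γ, (∀ s ∈ w, s ∈ S) ∧ w.prod = g ∧ w.length = n}

theorem wordLength_eq_wordNorm {Γ : Type*} [Group Γ] (S : Set Γ) (g : Γ) :
    wordLength S g = wordNorm S g := rfl

section WordNorm

variable {Γ : Type*} [Group Γ] {S : Set Γ}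

theorem wordNorm_le {w : List Γ} (hw : ∀ s ∈ w, s ∈ S) : wordNorm S w.prod ≤ w.length :=
  Nat.sInf_le ⟨w, hw, rfl, rfl⟩

theorem wordNorm_one : wordNorm S (1 : Γ) = 0 :=
  Nat.le_zero.1 (wordNorm_le (w := []) (by simp))

theorem exists_word (hsymm : S⁻¹ = S) (hgen : Subgroup.closure S = ⊤) (g : Γ) :
    ∃ w : List Γ, (∀ s ∈ w, s ∈ S) ∧ w.prod = g ∧ w.length = wordNorm S g := by
  have hg : g ∈ Submonoid.closure S := by
    rw [← Set.union_self S]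
    nth_rewrite 2 [← hsymm]
    rw [← Subgroup.closure_toSubmonoid, hgen]
    trivial
  obtain ⟨w, hw, hwg⟩ := Submonoid.exists_list_of_mem_closure hg
  exact Nat.sInf_mem (s := {n : ℕ | ∃ w : List Γ, (∀ s ∈ w, s ∈ S) ∧ w.prod = g ∧ w.length = n})
    ⟨w.length, w, hw, hwg, rfl⟩

theorem eq_one_of_wordNorm_eq_zero (hsymm : S⁻¹ = S) (hgen : Subgroup.closure S = ⊤) {g : Γ}
    (h : wordNorm S g = 0) : g = 1 := by
  obtain ⟨w, -, hg, hl⟩ := exists_word hsymm hgen g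
  rw [h, List.length_eq_zero_iff] at hl
  rw [← hg, hl, List.prod_nil]

theorem wordNorm_mul_le (hsymm : S⁻¹ = S) (hgen : Subgroup.closure S = ⊤) (g h : Γ) :
    wordNorm S (g * h) ≤ wordNorm S g + wordNorm S h := by
  obtain ⟨v, hv, hg, hvl⟩ := exists_word hsymm hgen g
  obtain ⟨w, hw, hh, hwl⟩ := exists_word hsymm hgen h
  have := wordNorm_le (S := S) (w := v ++ w) fun s hs =>
    (List.mem_append.1 hs).elim (hv s) (hw s)
  rwa [List.prod_append, List.length_append, hg, hh, hvl, hwl] at this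

theorem wordNorm_inv_le (hsymm : S⁻¹ = S) (hgen : Subgroup.closure S = ⊤) (g : Γ) :
    wordNorm S g⁻¹ ≤ wordNorm S g := by
  obtain ⟨w, hw, hg, hwl⟩ := exists_word hsymm hgen g
  have := wordNorm_le (S := S) (w := (w.map (·⁻¹)).reverse) fun s hs => by
    rw [List.mem_reverse, List.mem_map] at hs
    obtain ⟨t, ht, rfl⟩ := hs
    rw [← hsymm]
    simpa using hw t ht
  rwa [← List.prod_inv_reverse, List.length_reverse, List.length_map, hg, hwl] at this

theorem wordNorm_inv (hsymm : S⁻¹ = S) (hgen : Subgroup.closure S = ⊤) (g : Γ) :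
    wordNorm S g⁻¹ = wordNorm S g :=
  (wordNorm_inv_le hsymm hgen g).antisymm (by simpa using wordNorm_inv_le hsymm hgen g⁻¹)

theorem finite_setOf_wordNorm_le (hfin : S.Finite) (hsymm : S⁻¹ = S)
    (hgen : Subgroup.closure S = ⊤) (r : ℕ) : {g : Γ | wordNorm S g ≤ r}.Finite := by
  have := hfin.to_subtype
  refine ((List.finite_length_le S r).image fun w => (w.map Subtype.val).prod).subset ?_
  intro g hg
  obtain ⟨w, hw, hgw, hwl⟩ := exists_word hsymm hgen g
  refine ⟨w.attach.map fun s => ⟨s.1, hw s.1 s.2⟩, ?_, ?_⟩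
  · simpa [hwl] using hg
  · simp [hgw]

/-- A shortest word for `g` can be cut `n` letters before its end (or at its start, if it is
shorter than `n`): the points of a word metric space are joined by geodesics. -/
theorem exists_truncation (hsymm : S⁻¹ = S) (hgen : Subgroup.closure S = ⊤) (g : Γ) (n : ℕ) :
    ∃ z : Γ, wordNorm S z = wordNorm S g - n ∧ wordNorm S (g⁻¹ * z) ≤ n := by
  obtain ⟨w, hw, hg, hwl⟩ := exists_word hsymm hgen g
  set m := wordNorm S g - n with hm
  have hsplit : (w.take m).prod * (w.drop m).prod = g := by rw [← hg, List.prod_take_mul_prod_drop]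
  have h1 : wordNorm S (w.take m).prod ≤ m :=
    (wordNorm_le fun s hs => hw s (List.mem_of_mem_take hs)).trans (by simp)
  have h2 : wordNorm S (w.drop m).prod ≤ wordNorm S g - m :=
    (wordNorm_le fun s hs => hw s (List.mem_of_mem_drop hs)).trans (by simp [hwl])
  have h3 := wordNorm_mul_le hsymm hgen (w.take m).prod (w.drop m).prod
  rw [hsplit] at h3
  refine ⟨(w.take m).prod, by omega, ?_⟩
  have h4 : g⁻¹ * (w.take m).prod = ((w.drop m).prod)⁻¹ := by
    rw [← hsplit]; group
  rw [h4, wordNorm_inv hsymm hgen]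
  omega

theorem wordNorm_inv_mul_comm (hsymm : S⁻¹ = S) (hgen : Subgroup.closure S = ⊤) (x y : Γ) :
    wordNorm S (x⁻¹ * y) = wordNorm S (y⁻¹ * x) := by
  rw [← wordNorm_inv hsymm hgen, mul_inv_rev, inv_inv]

theorem wordNorm_inv_mul_le (hsymm : S⁻¹ = S) (hgen : Subgroup.closure S = ⊤) (x y z : Γ) :
    wordNorm S (x⁻¹ * z) ≤ wordNorm S (x⁻¹ * y) + wordNorm S (y⁻¹ * z) := by
  have := wordNorm_mul_le hsymm hgen (x⁻¹ * y) (y⁻¹ * z)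
  rwa [show x⁻¹ * y * (y⁻¹ * z) = x⁻¹ * z by group] at this

variable {G : Type*} [Group G]

theorem wordNorm_image_le (hsymm : S⁻¹ = S) (hgen : Subgroup.closure S = ⊤) (π : Γ →* G) (g : Γ) :
    wordNorm (π '' S) (π g) ≤ wordNorm S g := by
  obtain ⟨w, hw, hg, hwl⟩ := exists_word hsymm hgen g
  have := wordNorm_le (S := π '' S) (w := w.map π) fun s hs => by
    obtain ⟨t, ht, rfl⟩ := List.mem_map.1 hs
    exact ⟨t, hw t ht, rfl⟩
  rwa [← map_list_prod, hg, List.length_map, hwl] at this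

theorem symm_image (hsymm : S⁻¹ = S) (π : Γ →* G) : (π '' S)⁻¹ = π '' S := by
  rw [← Set.image_inv, hsymm]

theorem closure_image_eq_top (hgen : Subgroup.closure S = ⊤) (π : Γ →* G)
    (hπ : Function.Surjective π) : Subgroup.closure (π '' S) = ⊤ := by
  rw [← MonoidHom.map_closure, hgen, Subgroup.map_top_of_surjective π hπ]

theorem exists_lift_wordNorm_le (hsymm : S⁻¹ = S) (hgen : Subgroup.closure S = ⊤) (π : Γ →* G)
    (hπ : Function.Surjective π) (x : G) :
    ∃ g : Γ, π g = x ∧ wordNorm S g ≤ wordNorm (π '' S) x := by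
  obtain ⟨w, hw, hx, hwl⟩ := exists_word (symm_image hsymm π) (closure_image_eq_top hgen π hπ) x
  choose! σ hσ hσπ using hw
  refine ⟨(w.map σ).prod, ?_, ?_⟩
  · rw [map_list_prod, List.map_map, List.map_congr_left (g := id) (by simpa using hσπ),
      List.map_id, hx]
  · rw [← hwl, ← List.length_map (f := σ) (as := w)]
    refine wordNorm_le fun s hs => ?_
    obtain ⟨t, ht, rfl⟩ := List.mem_map.1 hs
    exact hσ t ht

end WordNorm

/-! ### Tent functions on a hyperbolic group -/

section Tent

variable {G : Type*} [Group G] {S : Set G}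

/-- The points which lie `n` steps before `y` on a geodesic from `1` to `y`; just the point `1`
if `y` has norm at most `n`. -/
def shadow (S : Set G) (n : ℕ) (y : G) : Set G :=
  {z | wordNorm S z = wordNorm S y - n ∧ wordNorm S (y⁻¹ * z) ≤ n}

/-- The tent function: `n` minus the distance from `x` to the set of the `y` whose shadow
contains `z`, cut off at `0`. -/
noncomputable def tent (S : Set G) (n : ℕ) (x z : G) : ℕ :=
  sSup {m : ℕ | ∃ y, z ∈ shadow S n y ∧ wordNorm S (x⁻¹ * y) + m ≤ n}

theorem bddAbove_tent (S : Set G) (n : ℕ) (x z : G) :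
    BddAbove {m : ℕ | ∃ y, z ∈ shadow S n y ∧ wordNorm S (x⁻¹ * y) + m ≤ n} :=
  ⟨n, fun m ⟨_, _, h⟩ => by omega⟩

theorem le_tent {n m : ℕ} {x y z : G} (hz : z ∈ shadow S n y)
    (h : wordNorm S (x⁻¹ * y) + m ≤ n) : m ≤ tent S n x z :=
  le_csSup (bddAbove_tent S n x z) ⟨y, hz, h⟩

theorem exists_of_tent_ne_zero {n : ℕ} {x z : G} (h : tent S n x z ≠ 0) :
    ∃ y, z ∈ shadow S n y ∧ wordNorm S (x⁻¹ * y) + tent S n x z ≤ n := by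
  refine Nat.sSup_mem (s := {m : ℕ | ∃ y, z ∈ shadow S n y ∧ wordNorm S (x⁻¹ * y) + m ≤ n})
    ?_ (bddAbove_tent S n x z)
  by_contra hne
  rw [Set.not_nonempty_iff_eq_empty] at hne
  exact h (by rw [tent, hne]; simp)

theorem tent_le (n : ℕ) (x z : G) : tent S n x z ≤ n := by
  by_cases h : tent S n x z = 0
  · omega
  · obtain ⟨y, -, hy⟩ := exists_of_tent_ne_zero h
    omega

theorem tent_le_add (hsymm : S⁻¹ = S) (hgen : Subgroup.closure S = ⊤) (n : ℕ) (x x' z : G) :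
    tent S n x z ≤ tent S n x' z + wordNorm S (x⁻¹ * x') := by
  by_cases h : tent S n x z = 0
  · omega
  · obtain ⟨y, hz, hy⟩ := exists_of_tent_ne_zero h
    have h1 := wordNorm_inv_mul_le hsymm hgen x' x y
    rw [wordNorm_inv_mul_comm hsymm hgen x' x] at h1
    have := le_tent (m := tent S n x z - wordNorm S (x⁻¹ * x')) (x := x') hz
    omega

theorem exists_tent_eq (hsymm : S⁻¹ = S) (hgen : Subgroup.closure S = ⊤) (n : ℕ) (x : G) :
    ∃ z, tent S n x z = n := by
  obtain ⟨z, hz⟩ := exists_truncation hsymm hgen x n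
  exact ⟨z, (tent_le n x z).antisymm (le_tent (y := x) hz (by simp [wordNorm_one]))⟩

theorem wordNorm_le_of_tent_ne_zero (hsymm : S⁻¹ = S) (hgen : Subgroup.closure S = ⊤)
    {n : ℕ} {x z : G} (h : tent S n x z ≠ 0) : wordNorm S (x⁻¹ * z) ≤ 2 * n := by
  obtain ⟨y, hz, hy⟩ := exists_of_tent_ne_zero h
  have := wordNorm_inv_mul_le hsymm hgen x y z
  have := hz.2
  omega

/-- Two points of equal norm in the support of a tent function are uniformly close: by
hyperbolicity, the geodesics from `1` to points of the `n`-ball around `x` have come together once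
they are `n` steps away from their end points. -/
theorem wordNorm_le_of_mem_shadow (hsymm : S⁻¹ = S) (hgen : Subgroup.closure S = ⊤) {ε : ℝ}
    (hε : ∀ o x y z : G,
      min (gromovProduct (lengthDist (wordLength S)) o x y)
        (gromovProduct (lengthDist (wordLength S)) o y z) - ε ≤
      gromovProduct (lengthDist (wordLength S)) o x z)
    {n : ℕ} {x y y' z z' : G} (hz : z ∈ shadow S n y) (hz' : z' ∈ shadow S n y')
    (hy : wordNorm S (x⁻¹ * y) ≤ n) (hy' : wordNorm S (x⁻¹ * y') ≤ n)
    (hzz' : wordNorm S z = wordNorm S z') : (wordNorm S (z⁻¹ * z') : ℝ) ≤ 6 * ε := by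
  have key : ∀ p q : G, gromovProduct (lengthDist (wordLength S)) 1 p q =
      (wordNorm S p + wordNorm S q - wordNorm S (p⁻¹ * q)) / 2 := fun p q => by
    simp [gromovProduct, lengthDist, wordLength_eq_wordNorm, wordNorm_inv hsymm hgen]
  -- The Gromov products of consecutive points in the chain `z, y, x, y', z'` are at least the
  -- common norm of `z` and `z'`.
  have low : ∀ p q : G, 2 * wordNorm S z + wordNorm S (p⁻¹ * q) ≤ wordNorm S p + wordNorm S q →
      (wordNorm S z : ℝ) ≤ gromovProduct (lengthDist (wordLength S)) 1 p q := fun p q h => by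
    have : (2 * wordNorm S z + wordNorm S (p⁻¹ * q) : ℝ) ≤ wordNorm S p + wordNorm S q := by
      exact_mod_cast h
    rw [key]; linarith
  have tri : ∀ p q : G, wordNorm S (p⁻¹ * q) ≤ wordNorm S p + wordNorm S q ∧
      wordNorm S p ≤ wordNorm S q + wordNorm S (p⁻¹ * q) := fun p q => by
    have h1 := wordNorm_inv_mul_le hsymm hgen p 1 q
    have h2 := wordNorm_inv_mul_le hsymm hgen 1 q p
    rw [wordNorm_inv_mul_comm hsymm hgen q p] at h2
    simp only [inv_one, one_mul, mul_one, wordNorm_inv hsymm hgen] at h1 h2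
    exact ⟨h1, h2⟩
  obtain ⟨a1, a2⟩ := hz
  obtain ⟨b1, b2⟩ := hz'
  have c1 := wordNorm_inv_mul_comm hsymm hgen y z
  have c2 := wordNorm_inv_mul_comm hsymm hgen y x
  have g1 := low z y (by have := tri z y; omega)
  have g2 := low y x (by have := tri y x; omega)
  have g3 := low x y' (by
    have := tri x y'; have := tri y' x
    have := wordNorm_inv_mul_comm hsymm hgen y' x; omega)
  have g4 := low y' z' (by have := tri y' z'; omega)
  have e1 := hε 1 z y z'
  have e2 := hε 1 y x z'
  have e3 := hε 1 x y' z'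
  have f3 := (sub_le_sub_right (le_min g3 g4) ε).trans e3
  have hε0 : 0 ≤ ε := by
    have := hε 1 1 1 1
    simpa using this
  have f2 := (sub_le_sub_right (le_min (by linarith) f3) ε).trans e2
  have f1 := (sub_le_sub_right (le_min (by linarith) f2) ε).trans e1
  rw [key, ← hzz'] at f1
  linarith

/-- The supports of the tent functions of height `n` grow only linearly with `n`: a bounded number
of points on each of the at most `2 n + 1` spheres around `1` that they meet. -/
theorem exists_card_tent_support_le (hfin : S.Finite) (hsymm : S⁻¹ = S)
    (hgen : Subgroup.closure S = ⊤) (hG : IsGromovHyperbolic (lengthDist (wordLength S))) :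
    ∃ B : ℕ, ∀ n ≥ 1, ∀ (x : G) (U : Finset G), (∀ z ∈ U, tent S n x z ≠ 0) →
      U.card ≤ B * n := by
  obtain ⟨ε, -, hε⟩ := hG
  have hball := finite_setOf_wordNorm_le hfin hsymm hgen ⌊6 * ε⌋₊
  classical
  refine ⟨3 * hball.toFinset.card, fun n hn x U hU => ?_⟩
  have h1 : U.card ≤ hball.toFinset.card *
      (Finset.Icc (wordNorm S x - 2 * n) (wordNorm S x)).card := by
    refine Finset.card_le_mul_card_image_of_maps_to (f := wordNorm S) (fun z hz => ?_) _
      fun r hr => ?_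
    · obtain ⟨y, hzy, hy⟩ := exists_of_tent_ne_zero (hU z hz)
      have t1 := wordNorm_mul_le hsymm hgen x (x⁻¹ * y)
      have t2 := wordNorm_mul_le hsymm hgen y (y⁻¹ * x)
      rw [mul_inv_cancel_left] at t1 t2
      have := wordNorm_inv_mul_comm hsymm hgen x y
      have := hzy.1
      rw [Finset.mem_Icc]
      omega
    · rcases Finset.eq_empty_or_nonempty (U.filter fun z => wordNorm S z = r) with h | ⟨z₀, h₀⟩
      · rw [h]; simp
      · rw [Finset.mem_filter] at h₀
        obtain ⟨y₀, hzy₀, hy₀⟩ := exists_of_tent_ne_zero (hU z₀ h₀.1)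
        refine Finset.card_le_card_of_injOn (fun z => z₀⁻¹ * z) (fun z hz => ?_)
          (fun z _ z' _ h => mul_left_cancel h)
        rw [Finset.mem_coe, Finset.mem_filter] at hz
        obtain ⟨y, hzy, hy⟩ := exists_of_tent_ne_zero (hU z hz.1)
        simp only [Set.Finite.coe_toFinset, Set.mem_ofPred_eq]
        exact Nat.le_floor (wordNorm_le_of_mem_shadow (x := x) hsymm hgen hε hzy₀ hzy (by omega) (by omega)
          (h₀.2.trans hz.2.symm))
  have h2 : (Finset.Icc (wordNorm S x - 2 * n) (wordNorm S x)).card ≤ 3 * n := by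
    rw [Nat.card_Icc]; omega
  calc U.card ≤ _ := h1
    _ ≤ hball.toFinset.card * (3 * n) := Nat.mul_le_mul_left _ h2
    _ = _ := by ring

/-- A quantitative form of property A for hyperbolic groups: for every `n` there are functions on
the group, indexed by its points `x`, which have height `n`, depend on `x` in a `1`-Lipschitz way,
are supported in the ball of radius `2 n` around `x`, and have at most `B n` points in their
support. -/
theorem exists_tent_family (hfin : S.Finite) (hsymm : S⁻¹ = S)
    (hgen : Subgroup.closure S = ⊤) (hG : IsGromovHyperbolic (lengthDist (wordLength S))) :
    ∃ B : ℕ, ∀ n : ℕ, 1 ≤ n → ∃ ξ : G → G →₀ ℝ,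
      (∀ x z, 0 ≤ ξ x z) ∧ (∀ x z, ξ x z ≤ n) ∧
      (∀ x x' z, |ξ x z - ξ x' z| ≤ wordNorm S (x⁻¹ * x')) ∧
      (∀ x z, ξ x z ≠ 0 → wordNorm S (x⁻¹ * z) ≤ 2 * n) ∧
      (∀ x, (ξ x).support.card ≤ B * n) ∧ (∀ x, ∃ z, ξ x z = n) := by
  obtain ⟨B, hB⟩ := exists_card_tent_support_le hfin hsymm hgen hG
  refine ⟨B, fun n hn => ?_⟩
  have hsupp : ∀ x, (Function.support fun z => (tent S n x z : ℝ)).Finite := fun x => by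
    refine ((finite_setOf_wordNorm_le hfin hsymm hgen (2 * n)).image fun g => x * g).subset
      fun z hz => ⟨x⁻¹ * z, ?_, by simp⟩
    exact wordNorm_le_of_tent_ne_zero hsymm hgen (by simpa using hz)
  refine ⟨fun x => Finsupp.ofSupportFinite _ (hsupp x), fun x z => ?_, fun x z => ?_,
    fun x x' z => ?_, fun x z h => ?_, fun x => ?_, fun x => ?_⟩
  · exact Nat.cast_nonneg (tent S n x z)
  · exact Nat.cast_le.2 (tent_le n x z)
  · have h1 := tent_le_add hsymm hgen n x x' z
    have h2 := tent_le_add hsymm hgen n x' x z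
    rw [wordNorm_inv_mul_comm hsymm hgen] at h2
    have h1' : (tent S n x z : ℝ) ≤ tent S n x' z + wordNorm S (x⁻¹ * x') := by exact_mod_cast h1
    have h2' : (tent S n x' z : ℝ) ≤ tent S n x z + wordNorm S (x⁻¹ * x') := by exact_mod_cast h2
    exact abs_sub_le_iff.2 ⟨sub_le_iff_le_add'.2 h1', sub_le_iff_le_add'.2 h2'⟩
  · exact wordNorm_le_of_tent_ne_zero hsymm hgen (Nat.cast_ne_zero.1 h)
  · exact hB n hn x _ fun z hz => Nat.cast_ne_zero.1 (Finsupp.mem_support_iff.1 hz)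
  · obtain ⟨z, hz⟩ := exists_tent_eq hsymm hgen n x
    exact ⟨z, congrArg (Nat.cast : ℕ → ℝ) hz⟩

end Tent

/-! ### Positive semidefinite kernels -/

section Kernel

open Filter Topology
open scoped Matrix ComplexOrder

variable {X : Type*}

theorem Matrix.posSemidef_of_tendsto {ι : Type*} {l : Filter ι} [l.NeBot]
    {K : ι → Matrix X X ℝ} {L : Matrix X X ℝ} (hK : ∀ i, (K i).PosSemidef)
    (hL : ∀ a b, Tendsto (fun i => K i a b) l (𝓝 (L a b))) : L.PosSemidef := by
  refine ⟨Matrix.IsHermitian.ext fun a b => ?_, fun c => ?_⟩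
  · exact tendsto_nhds_unique (((hL b a).star).congr fun i => (hK i).isHermitian.apply a b) (hL a b)
  · refine ge_of_tendsto' (tendsto_finsetSum _ fun a _ => tendsto_finsetSum _ fun b _ =>
      (tendsto_const_nhds.mul (hL a b)).mul tendsto_const_nhds) fun i => (hK i).2 c

variable {E : Type*} [NormedAddCommGroup E] [InnerProductSpace ℝ E]

theorem Matrix.posSemidef_inner (v : X → E) :
    (Matrix.of fun a b => inner ℝ (v a) (v b) : Matrix X X ℝ).PosSemidef := by
  refine ⟨Matrix.IsHermitian.ext fun a b => by simp [real_inner_comm], fun c => ?_⟩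
  have h : (c.sum fun a r => c.sum fun b s => star r * inner ℝ (v a) (v b) * s) =
      inner ℝ (c.sum fun a r => r • v a) (c.sum fun a r => r • v a) := by
    simp only [Finsupp.sum, sum_inner, inner_sum, real_inner_smul_left, real_inner_smul_right]
    exact Finset.sum_congr rfl fun a _ => Finset.sum_congr rfl fun b _ => by
      rw [star_trivial, real_inner_comm]; ring
  exact h ▸ real_inner_self_nonneg

theorem Matrix.posSemidef_rankOne (u : X → ℝ) :
    (Matrix.of fun a b => u a * u b : Matrix X X ℝ).PosSemidef := by
  simpa [mul_comm] using Matrix.posSemidef_inner u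

theorem Matrix.posSemidef_inner_pow (v : X → E) (k : ℕ) :
    (Matrix.of fun a b => inner ℝ (v a) (v b) ^ k : Matrix X X ℝ).PosSemidef := by
  induction k with
  | zero => simpa using Matrix.posSemidef_rankOne fun _ : X => (1 : ℝ)
  | succ k ih =>
    have := ih.hadamard (Matrix.posSemidef_inner v)
    refine cast (congrArg Matrix.PosSemidef ?_) this
    ext a b
    simp [pow_succ]

/-- The Gaussian kernel is positive semidefinite: up to a kernel of rank one it is the exponential
of the kernel `2 ⟪v a, v b⟫`, hence a limit of sums of Hadamard powers of Gram matrices. -/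
theorem Matrix.posSemidef_gaussian (v : X → E) :
    (Matrix.of fun a b => Real.exp (-‖v a - v b‖ ^ 2) : Matrix X X ℝ).PosSemidef := by
  have hexp : (Matrix.of fun a b => Real.exp (2 * inner ℝ (v a) (v b)) :
      Matrix X X ℝ).PosSemidef := by
    refine Matrix.posSemidef_of_tendsto (l := atTop) (K := fun n => ∑ k ∈ Finset.range n,
      (2 ^ k / k.factorial : ℝ) • (Matrix.of fun a b => inner ℝ (v a) (v b) ^ k))
      (fun n => Matrix.posSemidef_sum _ fun k _ =>
        (Matrix.posSemidef_inner_pow v k).smul (by positivity)) fun a b => ?_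
    have := (NormedSpace.expSeries_div_hasSum_exp (2 * inner ℝ (v a) (v b) : ℝ)).tendsto_sum_nat
    rw [← Real.exp_eq_exp_ℝ] at this
    refine this.congr fun n => ?_
    simp only [Matrix.sum_apply, Matrix.smul_apply, Matrix.of_apply, smul_eq_mul]
    exact Finset.sum_congr rfl fun k _ => by rw [mul_pow]; ring
  refine cast (congrArg Matrix.PosSemidef ?_)
    (hexp.hadamard (Matrix.posSemidef_rankOne fun a => Real.exp (-‖v a‖ ^ 2)))
  ext a b
  simp only [Matrix.hadamard_apply, Matrix.of_apply, ← Real.exp_add]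
  rw [norm_sub_sq_real]
  ring_nf

/-- A positive semidefinite real kernel on `X` is the Gram matrix of a family of vectors in a
Hilbert space, in the universe of `X`. -/
theorem Matrix.PosSemidef.exists_inner_eq {X : Type u} {K : Matrix X X ℝ} (hK : K.PosSemidef) :
    ∃ (V : Type u) (_ : NormedAddCommGroup V) (_ : InnerProductSpace ℝ V) (_ : CompleteSpace V)
      (Φ : X → V), ∀ a b, inner ℝ (Φ a) (Φ b) = K a b := by
  let K' : Matrix X X (ℝ →L[ℝ] ℝ) := Matrix.of fun a b => K a b • ContinuousLinearMap.id ℝ ℝ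
  have hs : ∀ a b, K a b = K b a := fun a b => by simpa using (hK.isHermitian.apply a b).symm
  have hK' : K'.PosSemidef := by
    have h := (RKHS.posSemidef_tfae (K := K')).out 0 2
    refine h.2 ⟨Matrix.IsHermitian.ext fun a b => ?_, fun c => ?_⟩
    · ext
      simp [K', hs a b, ContinuousLinearMap.star_eq_adjoint, ContinuousLinearMap.adjoint_id]
    · refine (hK.2 c).trans_eq (Finset.sum_congr rfl fun a _ => Finset.sum_congr rfl fun b _ => ?_)
      simp [K', hs b a]
      ring
  have : Fact K'.PosSemidef := ⟨hK'⟩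
  refine ⟨RKHS.OfKernel K', inferInstance, inferInstance, inferInstance,
    fun a => RKHS.kerFun (RKHS.OfKernel K') a 1, fun a b => ?_⟩
  rw [← RKHS.kernel_inner, RKHS.OfKernel.kernel_ofKernel]
  simp [K', hs a b]

/-- The feature map behind the gluing of local maps `φ · z` with weights `ξ · z`, where each local
map is made bounded by means of the Gaussian kernel. -/
theorem exists_gaussian_feature_map {X : Type u} {Z : Type*} (ξ : X → Z →₀ ℝ) (φ : X → Z → E) :
    ∃ (V : Type u) (_ : NormedAddCommGroup V) (_ : InnerProductSpace ℝ V) (_ : CompleteSpace V)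
      (Φ : X → V), ∀ a b (U : Finset Z), (ξ a).support ⊆ U → (ξ b).support ⊆ U →
        ‖Φ a - Φ b‖ ^ 2 = ∑ z ∈ U, ((ξ a z - ξ b z) ^ 2 +
          2 * (ξ a z * ξ b z) * (1 - Real.exp (-‖φ a z - φ b z‖ ^ 2))) := by
  let K : Matrix X X ℝ := Matrix.of fun a b =>
    ∑ z ∈ (ξ a).support, ξ a z * ξ b z * Real.exp (-‖φ a z - φ b z‖ ^ 2)
  have hKU : ∀ a b (U : Finset Z), (ξ a).support ⊆ U →
      K a b = ∑ z ∈ U, ξ a z * ξ b z * Real.exp (-‖φ a z - φ b z‖ ^ 2) := fun a b U hU =>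
    Finset.sum_subset hU fun z _ hz => by simp [Finsupp.notMem_support_iff.1 hz]
  have hK : K.PosSemidef := by
    classical
    refine Matrix.posSemidef_of_tendsto (l := (atTop : Filter (Finset Z)))
      (K := fun U => ∑ z ∈ U, (Matrix.of fun a b => ξ a z * ξ b z) ⊙
        (Matrix.of fun a b => Real.exp (-‖φ a z - φ b z‖ ^ 2)))
      (fun U => Matrix.posSemidef_sum _ fun z _ =>
        (Matrix.posSemidef_rankOne fun a => ξ a z).hadamard
          (Matrix.posSemidef_gaussian fun a => φ a z)) fun a b => ?_
    refine tendsto_const_nhds.congr' ?_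
    filter_upwards [eventually_ge_atTop (ξ a).support] with U hU
    rw [hKU a b U hU]
    simp [Matrix.sum_apply]
  obtain ⟨V, i1, i2, i3, Φ, hΦ⟩ := hK.exists_inner_eq
  refine ⟨V, i1, i2, i3, Φ, fun a b U ha hb => ?_⟩
  rw [norm_sub_sq_real, ← real_inner_self_eq_norm_sq, ← real_inner_self_eq_norm_sq, hΦ, hΦ, hΦ,
    hKU a a U ha, hKU a b U ha, hKU b b U hb, Finset.mul_sum, ← Finset.sum_sub_distrib,
    ← Finset.sum_add_distrib]
  refine Finset.sum_congr rfl fun z _ => ?_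
  simp only [sub_self, norm_zero, ne_eq, OfNat.ofNat_ne_zero, not_false_eq_true, zero_pow, neg_zero,
    Real.exp_zero]
  ring

end Kernel

/-! ### Sums of feature maps -/

/-- Maps into Hilbert spaces whose Lipschitz constants are square summable can be combined into
one Lipschitz map which expands distances at least as much as each of them. -/
theorem exists_sum_of_features {X : Type u} [Nonempty X] {V : ℕ → Type u}
    [∀ k, NormedAddCommGroup (V k)] [∀ k, InnerProductSpace ℝ (V k)] [∀ k, CompleteSpace (V k)]
    (Φ : ∀ k, X → V k) (d : X → X → ℝ) {M : ℝ} (hM : 0 ≤ M) (hd : ∀ x y, 0 ≤ d x y)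
    (hΦ : ∀ k x y, ‖Φ k x - Φ k y‖ ^ 2 ≤ (1 / 2) ^ k * (M * d x y ^ 2)) :
    ∃ (W : Type u) (_ : NormedAddCommGroup W) (_ : InnerProductSpace ℝ W) (_ : CompleteSpace W)
      (F : X → W), (∀ x y, ‖F x - F y‖ ≤ √(2 * M) * d x y) ∧
        ∀ k x y, ‖Φ k x - Φ k y‖ ≤ ‖F x - F y‖ := by
  obtain ⟨o⟩ := ‹Nonempty X›
  have hsum : ∀ x y, Summable fun k => ‖Φ k x - Φ k y‖ ^ 2 := fun x y =>
    Summable.of_nonneg_of_le (fun k => by positivity) (fun k => hΦ k x y)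
      (summable_geometric_two.mul_right _)
  have hmem : ∀ x, Memℓp (fun k => Φ k x - Φ k o) 2 := fun x =>
    memℓp_gen (by simpa using hsum x o)
  let F : X → lp V 2 := fun x => ⟨fun k => Φ k x - Φ k o, hmem x⟩
  have hF : ∀ x y k, (F x - F y) k = Φ k x - Φ k y := fun x y k => by
    rw [lp.coeFn_sub, Pi.sub_apply]
    exact sub_sub_sub_cancel_right _ _ _
  refine ⟨lp V 2, inferInstance, inferInstance, inferInstance, F, fun x y => ?_, fun k x y => ?_⟩
  · have h1 : ‖F x - F y‖ ^ 2 ≤ 2 * M * d x y ^ 2 := by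
      have h := lp.norm_rpow_eq_tsum (p := 2) (by simp) (F x - F y)
      simp only [ENNReal.toReal_ofNat, Real.rpow_ofNat, hF] at h
      rw [h]
      calc ∑' k, ‖Φ k x - Φ k y‖ ^ 2 ≤ ∑' k : ℕ, (1 / 2) ^ k * (M * d x y ^ 2) :=
            (hsum x y).tsum_le_tsum (fun k => hΦ k x y) (summable_geometric_two.mul_right _)
        _ = 2 * M * d x y ^ 2 := by rw [tsum_mul_right, tsum_geometric_two]; ring
    calc ‖F x - F y‖ ≤ √(2 * M * d x y ^ 2) := Real.le_sqrt_of_sq_le h1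
      _ = √(2 * M) * d x y := by rw [Real.sqrt_mul (by positivity), Real.sqrt_sq (hd x y)]
  · rw [← hF]
    exact lp.norm_apply_le_norm (by simp) (F x - F y) k

/-! ### Gluing over the quotient -/

section Extension

variable {H Γ G : Type*} [Group H] [Group Γ] [Group G] {S : Set Γ}

/-- Coordinates of `Γ` in `H` around each point `z` of the quotient: the part of `Γ` over the
`m`-ball around `z` is mapped to `H` with an additive error of `2 m`. -/
theorem GroupExtension.exists_local_coordinates (E : GroupExtension H Γ G) (hsymm : S⁻¹ = S)
    (hgen : Subgroup.closure S = ⊤) :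
    ∃ c : Γ → G → H, ∀ (a b : Γ) (z : G) (m : ℕ),
      wordNorm (E.rightHom '' S) ((E.rightHom a)⁻¹ * z) ≤ m →
      wordNorm (E.rightHom '' S) ((E.rightHom b)⁻¹ * z) ≤ m →
      wordNorm S (E.inl ((c a z)⁻¹ * c b z)) ≤ wordNorm S (a⁻¹ * b) + 2 * m ∧
      wordNorm S (a⁻¹ * b) ≤ wordNorm S (E.inl ((c a z)⁻¹ * c b z)) + 2 * m := by
  choose σ hσ hσle using exists_lift_wordNorm_le hsymm hgen E.rightHom E.rightHom_surjective
  have hmem : ∀ (a : Γ) (z : G), ∃ h : H,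
      E.inl h = (σ z)⁻¹ * a * (σ (z⁻¹ * E.rightHom a))⁻¹ := fun a z => by
    rw [← MonoidHom.mem_range, E.range_inl_eq_ker_rightHom, MonoidHom.mem_ker]
    simp only [map_mul, map_inv, hσ]
    group
  choose c hc using hmem
  refine ⟨c, fun a b z m ha hb => ?_⟩
  have hsymm' := symm_image hsymm E.rightHom
  have hgen' := closure_image_eq_top hgen E.rightHom E.rightHom_surjective
  rw [wordNorm_inv_mul_comm hsymm' hgen'] at ha hb
  set p := σ (z⁻¹ * E.rightHom a)
  set q := σ (z⁻¹ * E.rightHom b)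
  have hp : wordNorm S p ≤ m := (hσle _).trans ha
  have hq : wordNorm S q ≤ m := (hσle _).trans hb
  have e1 : E.inl ((c a z)⁻¹ * c b z) = p * (a⁻¹ * b) * q⁻¹ := by
    have hca : E.inl (c a z) = (σ z)⁻¹ * a * p⁻¹ := hc a z
    have hcb : E.inl (c b z) = (σ z)⁻¹ * b * q⁻¹ := hc b z
    rw [map_mul, map_inv, hca, hcb]; group
  have e2 : a⁻¹ * b = p⁻¹ * E.inl ((c a z)⁻¹ * c b z) * q := by
    rw [e1]; group
  have n1 := wordNorm_mul_le hsymm hgen (p * (a⁻¹ * b)) q⁻¹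
  have n2 := wordNorm_mul_le hsymm hgen p (a⁻¹ * b)
  have n3 := wordNorm_mul_le hsymm hgen (p⁻¹ * E.inl ((c a z)⁻¹ * c b z)) q
  have n4 := wordNorm_mul_le hsymm hgen p⁻¹ (E.inl ((c a z)⁻¹ * c b z))
  rw [← e1] at n1
  rw [← e2] at n3
  rw [wordNorm_inv hsymm hgen] at n1 n4
  omega

/-- The sum bounded here is the squared distance in `exists_gaussian_feature_map`, with `t z` the
squared distance of the two points in the local map at `z`. -/
theorem sum_gaussian_le {Z : Type*} (U : Finset Z) (ξ η t : Z → ℝ) {n d q : ℝ}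
    (hξ0 : ∀ z, 0 ≤ ξ z) (hη0 : ∀ z, 0 ≤ η z) (hξ : ∀ z, ξ z ≤ n) (hη : ∀ z, η z ≤ n)
    (hd : ∀ z, |ξ z - η z| ≤ d) (hq0 : 0 ≤ q) (hq : ∀ z, ξ z ≠ 0 → η z ≠ 0 → t z ≤ q) :
    ∑ z ∈ U, ((ξ z - η z) ^ 2 + 2 * (ξ z * η z) * (1 - Real.exp (-t z))) ≤
      U.card * (d ^ 2 + 2 * n ^ 2 * q) := by
  rw [← nsmul_eq_mul]
  refine Finset.sum_le_card_nsmul _ _ _ fun z _ => add_le_add (sq_le_sq.2 ?_) ?_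
  · exact (hd z).trans (le_abs_self d)
  · have hn : 0 ≤ n := (hξ0 z).trans (hξ z)
    by_cases h : ξ z = 0 ∨ η z = 0
    · have : ξ z * η z = 0 := mul_eq_zero.2 h
      rw [this, mul_zero, zero_mul]
      positivity
    · push Not at h
      have h1 : 1 - Real.exp (-t z) ≤ q := by
        have := Real.add_one_le_exp (-t z)
        linarith [hq z h.1 h.2]
      have h2 : ξ z * η z ≤ n ^ 2 := by
        rw [sq]; exact mul_le_mul (hξ z) (hη z) (hη0 z) hn
      have h3 : 0 ≤ ξ z * η z := mul_nonneg (hξ0 z) (hη0 z)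
      calc 2 * (ξ z * η z) * (1 - Real.exp (-t z)) ≤ 2 * (ξ z * η z) * q := by gcongr
        _ ≤ 2 * n ^ 2 * q := by gcongr

/-- Where both weights are nonzero, the hypothesis on `t` makes the Gaussian factor at most `1 / 2`,
so each summand is at least `ξ z ^ 2 - ξ z * η z + η z ^ 2`. -/
theorem le_sum_gaussian {Z : Type*} (U : Finset Z) (ξ η t : Z → ℝ) {n : ℝ} {z₀ : Z}
    (hz₀ : z₀ ∈ U) (hn : ξ z₀ = n) (hξ0 : ∀ z, 0 ≤ ξ z) (hη0 : ∀ z, 0 ≤ η z)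
    (ht : ∀ z, ξ z ≠ 0 → η z ≠ 0 → 1 ≤ t z) :
    n ^ 2 / 4 ≤ ∑ z ∈ U, ((ξ z - η z) ^ 2 + 2 * (ξ z * η z) * (1 - Real.exp (-t z))) := by
  have key : ∀ z, ξ z ^ 2 / 4 ≤ (ξ z - η z) ^ 2 + 2 * (ξ z * η z) * (1 - Real.exp (-t z)) := by
    intro z
    have h3 : 0 ≤ ξ z * η z := mul_nonneg (hξ0 z) (hη0 z)
    have h4 : ξ z * η z ≤ 2 * (ξ z * η z) * (1 - Real.exp (-t z)) := by
      by_cases h : ξ z = 0 ∨ η z = 0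
      · simp [mul_eq_zero.2 h]
      · push Not at h
        have h1 : Real.exp (-t z) ≤ 1 / 2 := by
          have h5 := Real.add_one_le_exp (t z)
          rw [Real.exp_neg, inv_eq_one_div]
          exact one_div_le_one_div_of_le two_pos (by linarith [ht z h.1 h.2])
        nlinarith
    nlinarith [sq_nonneg (ξ z - 2 * η z), sq_nonneg (ξ z)]
  calc n ^ 2 / 4 = ξ z₀ ^ 2 / 4 := by rw [hn]
    _ ≤ _ := key z₀
    _ ≤ _ := Finset.single_le_sum (f := fun z => (ξ z - η z) ^ 2 +
        2 * (ξ z * η z) * (1 - Real.exp (-t z)))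
        (fun z _ => (div_nonneg (sq_nonneg _) (by norm_num)).trans (key z)) hz₀

end Extension

/-- The map at scale `n`. Its Lipschitz constant is of order `√n`, and it separates by `n / 2` those
points of `Γ` whose distance is large enough for `f` to separate by `n ^ 2` any two points of `H`
at that distance, up to `4 n`. -/
theorem GroupExtension.exists_scale_map {H G : Type*} {Γ : Type u} [Group H] [Group Γ] [Group G]
    (E : GroupExtension H Γ G) {S : Set Γ} (hfin : S.Finite) (hsymm : S⁻¹ = S)
    (hgen : Subgroup.closure S = ⊤)
    (hG : IsGromovHyperbolic (lengthDist (wordLength (E.rightHom '' S))))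
    {E₀ : Type*} [NormedAddCommGroup E₀] [InnerProductSpace ℝ E₀] (f : H → E₀) {C D : ℝ}
    (hC : 0 ≤ C) (hD : 0 ≤ D)
    (hf : ∀ h h', ‖f h - f h'‖ ≤ C * wordNorm S (E.inl (h⁻¹ * h')) + D) :
    ∃ M ≥ (0 : ℝ), ∀ n : ℕ, 1 ≤ n →
      ∃ (V : Type u) (_ : NormedAddCommGroup V) (_ : InnerProductSpace ℝ V) (_ : CompleteSpace V)
        (Φ : Γ → V), (∀ a b, ‖Φ a - Φ b‖ ^ 2 ≤ n * (M * (wordNorm S (a⁻¹ * b) : ℝ) ^ 2)) ∧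
        ∀ a b, (∀ h h', wordNorm S (a⁻¹ * b) ≤ wordNorm S (E.inl (h⁻¹ * h')) + 4 * n →
          (n : ℝ) ^ 2 ≤ ‖f h - f h'‖) → (n : ℝ) / 2 ≤ ‖Φ a - Φ b‖ := by
  classical
  obtain ⟨B, hB⟩ := exists_tent_family (hfin.image E.rightHom) (symm_image hsymm E.rightHom)
    (closure_image_eq_top hgen E.rightHom E.rightHom_surjective) hG
  obtain ⟨c, hc⟩ := E.exists_local_coordinates hsymm hgen
  refine ⟨2 * B * (1 + 2 * (5 * C + D) ^ 2), by positivity, fun n hn => ?_⟩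
  obtain ⟨ξ, h0, hle, hlip, hnear, hcard, hmax⟩ := hB n hn
  obtain ⟨V, i1, i2, i3, Φ, hΦ⟩ := exists_gaussian_feature_map (fun a : Γ => ξ (E.rightHom a))
    (fun a z => ((n : ℝ) ^ 2)⁻¹ • f (c a z))
  have hn' : (1 : ℝ) ≤ n := by exact_mod_cast hn
  have hnorm : ∀ a b z, ‖((n : ℝ) ^ 2)⁻¹ • f (c a z) - ((n : ℝ) ^ 2)⁻¹ • f (c b z)‖ =
      ((n : ℝ) ^ 2)⁻¹ * ‖f (c a z) - f (c b z)‖ := fun a b z => by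
    rw [← smul_sub, norm_smul, Real.norm_of_nonneg (by positivity)]
  have hcoord : ∀ a b z, ξ (E.rightHom a) z ≠ 0 → ξ (E.rightHom b) z ≠ 0 →
      wordNorm S (E.inl ((c a z)⁻¹ * c b z)) ≤ wordNorm S (a⁻¹ * b) + 4 * n ∧
      wordNorm S (a⁻¹ * b) ≤ wordNorm S (E.inl ((c a z)⁻¹ * c b z)) + 4 * n := fun a b z ha hb => by
    have := hc a b z (2 * n) (hnear _ _ ha) (hnear _ _ hb)
    omega
  refine ⟨V, i1, i2, i3, Φ, fun a b => ?_, fun a b hab => ?_⟩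
  · by_cases hd0 : wordNorm S (a⁻¹ * b) = 0
    · have : b = a := by
        rw [← inv_mul_eq_one.1 (eq_one_of_wordNorm_eq_zero hsymm hgen hd0)]
      simp [this, wordNorm_one]
    have hd : (1 : ℝ) ≤ wordNorm S (a⁻¹ * b) := by exact_mod_cast Nat.one_le_iff_ne_zero.2 hd0
    set d : ℝ := ((wordNorm S (a⁻¹ * b) : ℕ) : ℝ) with hddef
    rw [hΦ a b _ Finset.subset_union_left Finset.subset_union_right]
    have hU : (((ξ (E.rightHom a)).support ∪ (ξ (E.rightHom b)).support).card : ℝ) ≤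
        2 * B * n := by
      have h1 := Finset.card_union_le (ξ (E.rightHom a)).support (ξ (E.rightHom b)).support
      have h2 := hcard (E.rightHom a)
      have h3 := hcard (E.rightHom b)
      have : ((ξ (E.rightHom a)).support ∪ (ξ (E.rightHom b)).support).card ≤ 2 * (B * n) := by
        omega
      calc _ ≤ ((2 * (B * n) : ℕ) : ℝ) := by exact_mod_cast this
        _ = _ := by push_cast; ring
    refine (sum_gaussian_le _ _ _ _ (n := n) (d := d)
      (q := (((n : ℝ) ^ 2)⁻¹ * ((5 * C + D) * n * d)) ^ 2) (h0 _) (h0 _) (hle _) (hle _)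
      (fun z => (hlip _ _ z).trans ?_) (by positivity) fun z ha hb => ?_).trans ?_
    · rw [hddef, ← map_inv, ← map_mul]
      exact_mod_cast wordNorm_image_le hsymm hgen E.rightHom _
    · rw [hnorm]
      gcongr
      have h1 : (wordNorm S (E.inl ((c a z)⁻¹ * c b z)) : ℝ) ≤ d + 4 * n := by
        rw [hddef]
        exact_mod_cast (hcoord a b z ha hb).1
      have h2 : 0 ≤ (d - 1) * (n - 1) := mul_nonneg (by linarith) (by linarith)
      calc _ ≤ _ := hf _ _
        _ ≤ C * (d + 4 * n) + D := by gcongr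
        _ ≤ C * (5 * (n * d)) + D * (n * d) := by
          refine add_le_add (mul_le_mul_of_nonneg_left ?_ hC) (le_mul_of_one_le_right hD ?_)
          · nlinarith
          · nlinarith
        _ = _ := by ring
    · have e : d ^ 2 + 2 * (n : ℝ) ^ 2 * (((n : ℝ) ^ 2)⁻¹ * ((5 * C + D) * n * d)) ^ 2 =
          (1 + 2 * (5 * C + D) ^ 2) * d ^ 2 := by
        field_simp
      rw [e]
      calc _ ≤ 2 * B * n * ((1 + 2 * (5 * C + D) ^ 2) * d ^ 2) := by gcongr
        _ = _ := by ring
  · obtain ⟨z₀, hz₀⟩ := hmax (E.rightHom a)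
    have h : (n : ℝ) ^ 2 / 4 ≤ ‖Φ a - Φ b‖ ^ 2 := by
      rw [hΦ a b _ Finset.subset_union_left Finset.subset_union_right]
      refine le_sum_gaussian _ _ _ _ (z₀ := z₀) (Finset.mem_union_left _ ?_) hz₀ (h0 _) (h0 _)
        fun z ha hb => ?_
      · rw [Finsupp.mem_support_iff, hz₀]; linarith
      · have := hab (c a z) (c b z) (hcoord a b z ha hb).2
        rw [hnorm]
        refine one_le_pow₀ ?_
        rwa [inv_mul_eq_div, one_le_div (by positivity)]
    refine le_of_sq_le_sq ?_ (norm_nonneg _)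
    calc ((n : ℝ) / 2) ^ 2 = n ^ 2 / 4 := by ring
      _ ≤ _ := h

/-- If `H` has compression exponent `δ`, then `Γ` has compression exponent `δ / 5`: the maps at the
scales `32 ^ k`, with weights `8 ^ (-k)`, have square summable Lipschitz constants, and the `k`-th
one separates points at distance of order `(1024 ^ k) ^ (1 / δ)` by `4 ^ k / 2`. -/
theorem GroupExtension.isCompressionExponent_div_five {H Γ G : Type*} [Group H] [Group Γ] [Group G]
    (E : GroupExtension H Γ G) {S : Set Γ} (hfin : S.Finite) (hsymm : S⁻¹ = S)
    (hgen : Subgroup.closure S = ⊤)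
    (hG : IsGromovHyperbolic (lengthDist (wordLength (E.rightHom '' S)))) {δ : ℝ} (hδ0 : 0 ≤ δ)
    (hδ1 : δ ≤ 1)
    (hH : IsCompressionExponent (lengthDist fun h : H => wordLength S (E.inl h)) δ) :
    IsCompressionExponent (lengthDist (wordLength S)) (δ / 5) := by
  obtain ⟨E₀, _, _, _, f, ⟨C, hC, D, hD, hup⟩, C', hC', D', hD', hlow⟩ := hH
  simp only [lengthDist, wordLength_eq_wordNorm] at hup hlow
  obtain ⟨M, hM, hV⟩ := E.exists_scale_map hfin hsymm hgen hG f hC.le hD hup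
  choose V i1 i2 i3 Φ hΦup hΦlow using fun k : ℕ => hV (32 ^ k) (Nat.one_le_pow _ _ (by norm_num))
  have hw : ∀ k a b, ‖((1 / 8 : ℝ) ^ k • Φ k a) - ((1 / 8 : ℝ) ^ k • Φ k b)‖ =
      (1 / 8) ^ k * ‖Φ k a - Φ k b‖ := fun k a b => by
    rw [← smul_sub, norm_smul, Real.norm_of_nonneg (by positivity)]
  obtain ⟨W, j1, j2, j3, F, hFup, hFlow⟩ := exists_sum_of_features
    (fun k a => (1 / 8 : ℝ) ^ k • Φ k a) (fun a b => (wordNorm S (a⁻¹ * b) : ℝ)) hM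
    (fun _ _ => Nat.cast_nonneg _) fun k a b => by
      rw [hw, mul_pow]
      calc ((1 / 8 : ℝ) ^ k) ^ 2 * ‖Φ k a - Φ k b‖ ^ 2 ≤
            ((1 / 8 : ℝ) ^ k) ^ 2 * (((32 ^ k : ℕ) : ℝ) * (M * (wordNorm S (a⁻¹ * b) : ℝ) ^ 2)) := by
            gcongr; exact hΦup k a b
        _ = _ := by
          rw [← pow_mul, mul_comm k 2, pow_mul, Nat.cast_pow, ← mul_assoc, ← mul_pow]
          norm_num
  set c := max 64 (2 * (C' * (1 + D')))
  have hc64 : 64 ≤ c := le_max_left _ _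
  have hcC : 2 * (C' * (1 + D')) ≤ c := le_max_right _ _
  have hc0 : 0 < c := by linarith
  have hsep : ∀ (k : ℕ) a b, c * 1024 ^ k ≤ (wordNorm S (a⁻¹ * b) : ℝ) ^ δ →
      4 ^ k / 2 ≤ ‖F a - F b‖ := by
    intro k a b hk
    set d : ℝ := ((wordNorm S (a⁻¹ * b) : ℕ) : ℝ) with hd
    have hpow : (1024 : ℝ) ^ k = (32 ^ k) ^ 2 := by
      rw [← pow_mul, mul_comm k 2, pow_mul]; norm_num
    have h32 : (1 : ℝ) ≤ 32 ^ k := one_le_pow₀ (by norm_num)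
    have hd1 : 1 ≤ d := by
      by_contra hlt
      have : d ^ δ ≤ 1 := Real.rpow_le_one (Nat.cast_nonneg _) (not_le.1 hlt).le hδ0
      nlinarith
    have hdδ : d ^ δ ≤ d := by simpa using Real.rpow_le_rpow_of_exponent_le hd1 hδ1
    -- The error `4 * 32 ^ k` of the local coordinates is at most half of the distance.
    have hd8 : 8 * 32 ^ k ≤ d := by
      rw [hpow] at hk
      nlinarith
    have hmain : ((32 ^ k : ℕ) : ℝ) / 2 ≤ ‖Φ k a - Φ k b‖ := by
      refine hΦlow k a b fun h h' hh' => ?_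
      set r : ℝ := ((wordNorm S (E.inl (h⁻¹ * h')) : ℕ) : ℝ) with hr
      have hdr : d ≤ r + 4 * 32 ^ k := by
        rw [hd, hr]
        exact_mod_cast hh'
      have h1 : d / 2 ≤ r := by linarith
      have h2 : d ^ δ / 2 ≤ r ^ δ := by
        calc d ^ δ / 2 ≤ d ^ δ / 2 ^ δ := by
              gcongr
              simpa using Real.rpow_le_rpow_of_exponent_le (x := 2) (by norm_num) hδ1
          _ = (d / 2) ^ δ := (Real.div_rpow (by linarith) (by norm_num) δ).symm
          _ ≤ r ^ δ := Real.rpow_le_rpow (by linarith) h1 hδ0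
      have h3 : C' * (1 + D') * 1024 ^ k ≤ r ^ δ := by
        have : 2 * (C' * (1 + D')) * 1024 ^ k ≤ c * 1024 ^ k := by gcongr
        linarith
      have h4 : (1 + D') * 1024 ^ k ≤ 1 / C' * r ^ δ := by
        rw [one_div, inv_mul_eq_div, le_div_iff₀ hC']
        linarith
      have h5 := hlow h h'
      have h6 : D' ≤ D' * 1024 ^ k := le_mul_of_one_le_right hD'.le (one_le_pow₀ (by norm_num))
      push_cast
      rw [← hpow]
      linarith
    have h7 := hFlow k a b
    rw [hw] at h7
    refine le_trans ?_ h7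
    calc (4 : ℝ) ^ k / 2 = (1 / 8) ^ k * (((32 ^ k : ℕ) : ℝ) / 2) := by
          rw [Nat.cast_pow, ← mul_div_assoc, ← mul_pow]; norm_num
      _ ≤ _ := by gcongr
  refine ⟨W, j1, j2, j3, F, ⟨√(2 * M) + 1, by positivity, 0, le_rfl, fun a b => ?_⟩,
    8 * c ^ (1 / 5 : ℝ), by positivity, 1, one_pos, fun a b => ?_⟩
  · refine (hFup a b).trans ?_
    simp only [lengthDist, wordLength_eq_wordNorm]
    have : (0 : ℝ) ≤ wordNorm S (a⁻¹ * b) := Nat.cast_nonneg _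
    linarith
  · simp only [lengthDist, wordLength_eq_wordNorm]
    set d : ℝ := ((wordNorm S (a⁻¹ * b) : ℕ) : ℝ) with hd
    have hd0 : 0 ≤ d := Nat.cast_nonneg _
    have hroot : d ^ (δ / 5) = (d ^ δ) ^ (1 / 5 : ℝ) := by
      rw [← Real.rpow_mul hd0]; ring_nf
    have hc5 : 0 < c ^ (1 / 5 : ℝ) := Real.rpow_pos_of_pos hc0 _
    rw [hroot, sub_le_iff_le_add, one_div_mul_eq_div, div_le_iff₀ (by positivity)]
    rcases lt_or_ge (d ^ δ) c with hlt | hge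
    · have : (d ^ δ) ^ (1 / 5 : ℝ) ≤ c ^ (1 / 5 : ℝ) :=
        Real.rpow_le_rpow (Real.rpow_nonneg hd0 _) hlt.le (by norm_num)
      nlinarith [norm_nonneg (F a - F b)]
    · obtain ⟨k, hk1, hk2⟩ := exists_nat_pow_near (x := d ^ δ / c) (y := 1024)
        ((one_le_div hc0).2 hge) (by norm_num)
      rw [le_div_iff₀' hc0] at hk1
      rw [div_lt_iff₀' hc0] at hk2
      have h1 := hsep k a b hk1
      have h2 : (d ^ δ) ^ (1 / 5 : ℝ) ≤ c ^ (1 / 5 : ℝ) * 4 ^ (k + 1) := by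
        calc (d ^ δ) ^ (1 / 5 : ℝ) ≤ (c * 1024 ^ (k + 1)) ^ (1 / 5 : ℝ) :=
              Real.rpow_le_rpow (Real.rpow_nonneg hd0 _) hk2.le (by norm_num)
          _ = c ^ (1 / 5 : ℝ) * ((4 ^ (k + 1)) ^ 5) ^ (1 / 5 : ℝ) := by
            rw [Real.mul_rpow hc0.le (by positivity), ← pow_mul, mul_comm (k + 1) 5, pow_mul]
            norm_num
          _ = c ^ (1 / 5 : ℝ) * 4 ^ (k + 1) := by
            rw [one_div]
            congr 1
            exact_mod_cast Real.pow_rpow_inv_natCast (x := 4 ^ (k + 1)) (n := 5) (by positivity)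
              (by norm_num)
      calc _ ≤ _ := h2
        _ = 8 * c ^ (1 / 5 : ℝ) * (4 ^ k / 2) := by ring
        _ ≤ 8 * c ^ (1 / 5 : ℝ) * (‖F a - F b‖ + 1) := by gcongr; linarith
        _ = _ := by ring

theorem mainTheorem3 {H Γ G : Type*} [Group H] [Group Γ] [Group G]
    (E : GroupExtension H Γ G)
    (S : Set Γ) (hfin : S.Finite) (hsymm : S⁻¹ = S) (hgen : Subgroup.closure S = ⊤)
    (hG : IsGromovHyperbolic (lengthDist (wordLength (E.rightHom '' S)))) :
    hilbertCompression (lengthDist fun h : H => wordLength S (E.inl h)) / 5 ≤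
      hilbertCompression (lengthDist (wordLength S)) := by
  rw [div_le_iff₀' (by norm_num)]
  refine Real.sSup_le (fun δ ⟨h0, h1, hδ⟩ => ?_)
    (mul_nonneg (by norm_num) (Real.sSup_nonneg fun δ hδ => hδ.1))
  rw [← div_le_iff₀' (by norm_num)]
  exact le_csSup ⟨1, fun _ h => h.2.1⟩ ⟨by positivity, by linarith,
    E.isCompressionExponent_div_five hfin hsymm hgen hG h0 h1 hδ⟩
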